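/- Let $n \in \mathbb{N} = \{1,2,\dots\}$ and let $\emptyset \neq \Omega \subset \mathbb{R}^n$ be an open set of finite $n$-dimensional Lebesgue measure, $|\Omega| < \infty$. For $k \in \mathbb{N}$ and $p \in [1,\infty)$ let $$W^{k,p}(\Omega) = \{u \in L^1_{\rm loc}(\Omega) \mid \partial^\alpha u \in L^p(\Omega) \text{ for all } \alpha \in \mathbb{N}_0^n,\ 0 \le |\alpha| \le k\},$$ where the derivatives are taken in the sense of distributions, with the norm $$\|u\|_{W^{k,p}(\Omega)} = \sum_{0 \le |\alpha| \le k} \|\partial^\alpha u\|_{L^p(\Omega)},$$ and let $\mathring{W}^{k,p}(\Omega)$ be the closure of $C_0^\infty(\Omega)$ in $W^{k,p}(\Omega)$, with the norm of $W^{k,p}(\Omega)$. (Functions are real- or complex-valued.) Then for each $k \in \mathbb{N}$ and $p \in [1,\infty)$, the space $\mathring{W}^{k,p}(\Omega)$ embeds compactly into $L^p(\Omega)$; that is, the inclusion map $\mathring{W}^{k,p}(\Omega) \to L^p(\Omega)$, $u \mapsto u$, is an injective, continuous and compact linear operator. -/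

import Mathlib

open MeasureTheory TopologicalSpace LineDeriv
open scoped Distributions ENNReal

noncomputable section

/-- The finite set of multi-indices `α ∈ ℕ₀ⁿ` of length `|α| = α₁ + ⋯ + αₙ` at most `k`. -/
def multiIndices (n k : ℕ) : Finset (Fin n → ℕ) :=
  {α ∈ Finset.Iic (fun _ => k) | ∑ i, α i ≤ k}

theorem mem_multiIndices {n k : ℕ} {α : Fin n → ℕ} :
    α ∈ multiIndices n k ↔ ∑ i, α i ≤ k := by
  simp only [multiIndices, Finset.mem_filter, Finset.mem_Iic, and_iff_right_iff_imp]
  intro h i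
  exact (Finset.single_le_sum (fun j _ => Nat.zero_le (α j)) (Finset.mem_univ i)).trans h

/-- The classical partial derivative `∂^α φ = ∂₁^{α₁} ⋯ ∂ₙ^{αₙ} φ` of a test function
`φ ∈ C₀^∞(Ω)`. -/
def testDeriv {𝕜 : Type*} [RCLike 𝕜] {n : ℕ} {Ω : Opens (EuclideanSpace ℝ (Fin n))}
    (α : Fin n → ℕ) (φ : 𝓓(Ω, 𝕜)) : 𝓓(Ω, 𝕜) :=
  (List.finRange n).foldr
    (fun i ψ => (fun η : 𝓓(Ω, 𝕜) => ∂_{EuclideanSpace.single i (1 : ℝ)} η)^[α i] ψ) φ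

/-- The Lebesgue space `L^p(Ω)` with respect to Lebesgue measure on `Ω`. -/
abbrev LpOn (𝕜 : Type*) [RCLike 𝕜] {n : ℕ} (Ω : Opens (EuclideanSpace ℝ (Fin n))) (p : ℝ≥0∞) :=
  Lp 𝕜 p ((volume : Measure (EuclideanSpace ℝ (Fin n))).restrict Ω)

/-- `v = ∂^α u` in the sense of distributions on `Ω`, for `u, v ∈ L^p(Ω)`. -/
def IsWeakDeriv {𝕜 : Type*} [RCLike 𝕜] {n : ℕ} {Ω : Opens (EuclideanSpace ℝ (Fin n))} {p : ℝ≥0∞}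
    (α : Fin n → ℕ) (u v : LpOn 𝕜 Ω p) : Prop :=
  ∀ φ : 𝓓(Ω, 𝕜), ∫ x in (Ω : Set (EuclideanSpace ℝ (Fin n))), u x * testDeriv α φ x =
    (-1) ^ (∑ i, α i) * ∫ x in (Ω : Set (EuclideanSpace ℝ (Fin n))), v x * φ x

section WeakDeriv

variable {𝕜 : Type*} [RCLike 𝕜] {n : ℕ} {Ω : Opens (EuclideanSpace ℝ (Fin n))} {p : ℝ≥0∞}
  {α : Fin n → ℕ} {u u' v v' : LpOn 𝕜 Ω p}

theorem LpOn.locallyIntegrable [hp : Fact (1 ≤ p)] (u : LpOn 𝕜 Ω p) :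
    LocallyIntegrable u (volume.restrict (Ω : Set (EuclideanSpace ℝ (Fin n)))) :=
  (Lp.memLp u).locallyIntegrable hp.out

theorem LpOn.integrable_mul [Fact (1 ≤ p)] (u : LpOn 𝕜 Ω p) (φ : 𝓓(Ω, 𝕜)) :
    IntegrableOn (fun x => u x * φ x) (Ω : Set (EuclideanSpace ℝ (Fin n))) := by
  have h := (LpOn.locallyIntegrable u).integrable_smul_right_of_hasCompactSupport
    φ.continuous φ.hasCompactSupport
  simpa [IntegrableOn] using h

theorem IsWeakDeriv.add [Fact (1 ≤ p)] (h : IsWeakDeriv α u v) (h' : IsWeakDeriv α u' v') :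
    IsWeakDeriv α (u + u') (v + v') := by
  intro φ
  have e1 : ∀ (a b : LpOn 𝕜 Ω p) (ψ : 𝓓(Ω, 𝕜)),
      ∫ x in (Ω : Set (EuclideanSpace ℝ (Fin n))), (a + b : LpOn 𝕜 Ω p) x * ψ x =
      (∫ x in (Ω : Set (EuclideanSpace ℝ (Fin n))), a x * ψ x) +
      ∫ x in (Ω : Set (EuclideanSpace ℝ (Fin n))), b x * ψ x := by
    intro a b ψ
    rw [← integral_add (LpOn.integrable_mul a ψ) (LpOn.integrable_mul b ψ)]
    refine integral_congr_ae ?_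
    filter_upwards [Lp.coeFn_add a b] with x hx
    rw [hx, Pi.add_apply, add_mul]
  rw [e1, e1, h φ, h' φ, mul_add]

theorem IsWeakDeriv.smul (c : 𝕜) (h : IsWeakDeriv α u v) : IsWeakDeriv α (c • u) (c • v) := by
  intro φ
  have e1 : ∀ (a : LpOn 𝕜 Ω p) (ψ : 𝓓(Ω, 𝕜)),
      ∫ x in (Ω : Set (EuclideanSpace ℝ (Fin n))), (c • a : LpOn 𝕜 Ω p) x * ψ x =
      c * ∫ x in (Ω : Set (EuclideanSpace ℝ (Fin n))), a x * ψ x := by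
    intro a ψ
    rw [← integral_const_mul]
    refine integral_congr_ae ?_
    filter_upwards [Lp.coeFn_smul c a] with x hx
    rw [hx, Pi.smul_apply, smul_eq_mul, mul_assoc]
  rw [e1, e1, h φ, mul_left_comm]

theorem IsWeakDeriv.zero : IsWeakDeriv α (0 : LpOn 𝕜 Ω p) 0 := by
  intro φ
  have e1 : ∀ ψ : 𝓓(Ω, 𝕜),
      ∫ x in (Ω : Set (EuclideanSpace ℝ (Fin n))), (0 : LpOn 𝕜 Ω p) x * ψ x = 0 := by
    intro ψ
    refine integral_eq_zero_of_ae ?_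
    filter_upwards [Lp.coeFn_zero 𝕜 p
      ((volume : Measure (EuclideanSpace ℝ (Fin n))).restrict Ω)] with x hx
    rw [hx]; simp
  rw [e1, e1, mul_zero]

/-- Weak derivatives are unique. -/
theorem IsWeakDeriv.unique [hp : Fact (1 ≤ p)] (h : IsWeakDeriv α u v) (h' : IsWeakDeriv α u v') :
    v = v' := by
  have key : ∀ φ : 𝓓(Ω, 𝕜), ∫ x in (Ω : Set (EuclideanSpace ℝ (Fin n))), v x * φ x =
      ∫ x in (Ω : Set (EuclideanSpace ℝ (Fin n))), v' x * φ x := by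
    intro φ
    have := (h φ).symm.trans (h' φ)
    exact mul_left_cancel₀ (pow_ne_zero _ (by norm_num)) this
  have hloc : ∀ w : LpOn 𝕜 Ω p,
      LocallyIntegrableOn w (Ω : Set (EuclideanSpace ℝ (Fin n))) volume := by
    intro w
    refine (locallyIntegrableOn_iff Ω.isOpen.isLocallyClosed).2 fun K hK hKc => ?_
    have := (LpOn.locallyIntegrable w).integrableOn_isCompact hKc
    rwa [IntegrableOn, Measure.restrict_restrict hKc.measurableSet,
      Set.inter_eq_left.2 hK] at this
  have hz := Ω.isOpen.ae_eq_zero_of_integral_contDiff_smul_eq_zero (μ := volume)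
    ((hloc v).sub (hloc v')) (fun g hg hgc hgs => by
      let φ : 𝓓(Ω, 𝕜) := ⟨fun x => ((g x : ℝ) : 𝕜),
        (RCLike.ofRealCLM (K := 𝕜)).contDiff.comp hg,
        hgc.comp_left (g := fun r : ℝ => (r : 𝕜)) (by simp),
        (closure_mono (Function.support_comp_subset (g := fun r : ℝ => (r : 𝕜))
          (by simp) g)).trans hgs⟩
      have hφ : ∀ x, φ x = ((g x : ℝ) : 𝕜) := fun _ => rfl
      have e := sub_eq_zero.2 (key φ)
      rw [← integral_sub (LpOn.integrable_mul v φ) (LpOn.integrable_mul v' φ)] at e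
      rw [← setIntegral_eq_integral_of_forall_compl_eq_zero
        (s := (Ω : Set (EuclideanSpace ℝ (Fin n)))), ← e]
      · refine integral_congr_ae (Filter.Eventually.of_forall fun x => ?_)
        simp only [Pi.sub_apply, hφ, RCLike.real_smul_eq_coe_mul]
        ring
      · intro x hx
        have : g x = 0 := image_eq_zero_of_notMem_tsupport fun h => hx (hgs h)
        simp [this])
  refine Lp.ext ?_
  rw [Filter.EventuallyEq, ae_restrict_iff' Ω.isOpen.measurableSet]
  filter_upwards [hz] with x hx hxΩ
  exact sub_eq_zero.1 (hx hxΩ)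

end WeakDeriv

/-- The Sobolev functions of order `k`: those `u` such that `∂^α u ∈ L^p(Ω)` in the sense of
distributions for all `|α| ≤ k`. The case `α = 0` makes `u` an element of `L^p(Ω)`. -/
def sobolevSubmodule (𝕜 : Type*) [RCLike 𝕜] {n : ℕ} (Ω : Opens (EuclideanSpace ℝ (Fin n)))
    (k : ℕ) (p : ℝ≥0∞) [Fact (1 ≤ p)] : Submodule 𝕜 (LpOn 𝕜 Ω p) where
  carrier := {u | ∀ α ∈ multiIndices n k, ∃ v : LpOn 𝕜 Ω p, IsWeakDeriv α u v}
  zero_mem' _ _ := ⟨0, IsWeakDeriv.zero⟩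
  add_mem' hu hu' α hα :=
    let ⟨v, hv⟩ := hu α hα
    let ⟨v', hv'⟩ := hu' α hα
    ⟨v + v', hv.add hv'⟩
  smul_mem' c _ hu α hα :=
    let ⟨v, hv⟩ := hu α hα
    ⟨c • v, hv.smul c⟩

/-- The Sobolev space `W^{k,p}(Ω)`. It is a type of its own, because its norm is not the one
of `L^p(Ω)`. -/
def SobolevSpace (𝕜 : Type*) [RCLike 𝕜] {n : ℕ} (Ω : Opens (EuclideanSpace ℝ (Fin n)))
    (k : ℕ) (p : ℝ≥0∞) [Fact (1 ≤ p)] : Type _ :=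
  ↥(sobolevSubmodule 𝕜 Ω k p)

namespace SobolevSpace

variable {𝕜 : Type*} [RCLike 𝕜] {n : ℕ} {Ω : Opens (EuclideanSpace ℝ (Fin n))}
  {k : ℕ} {p : ℝ≥0∞} [Fact (1 ≤ p)]

instance : AddCommGroup (SobolevSpace 𝕜 Ω k p) :=
  inferInstanceAs (AddCommGroup ↥(sobolevSubmodule 𝕜 Ω k p))

instance : Module 𝕜 (SobolevSpace 𝕜 Ω k p) :=
  inferInstanceAs (Module 𝕜 ↥(sobolevSubmodule 𝕜 Ω k p))

/-- A Sobolev function, regarded as an element of `L^p(Ω)`. -/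
def toLp : SobolevSpace 𝕜 Ω k p →ₗ[𝕜] LpOn 𝕜 Ω p :=
  (sobolevSubmodule 𝕜 Ω k p).subtype

theorem toLp_injective : Function.Injective (toLp : SobolevSpace 𝕜 Ω k p →ₗ[𝕜] LpOn 𝕜 Ω p) :=
  Subtype.val_injective

/-- The weak derivative `∂^α u ∈ L^p(Ω)` of `u ∈ W^{k,p}(Ω)`, for `|α| ≤ k`. -/
def weakDeriv (α : multiIndices n k) (u : SobolevSpace 𝕜 Ω k p) : LpOn 𝕜 Ω p :=
  (u.2 α.1 α.2).choose

theorem isWeakDeriv_weakDeriv (α : multiIndices n k) (u : SobolevSpace 𝕜 Ω k p) :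
    IsWeakDeriv α.1 (toLp u) (weakDeriv α u) :=
  (u.2 α.1 α.2).choose_spec

/-- The linear map `u ↦ (∂^α u)_{|α| ≤ k}` into the `ℓ¹`-direct sum of copies of `L^p(Ω)`. -/
def jet : SobolevSpace 𝕜 Ω k p →ₗ[𝕜] PiLp 1 (fun _ : multiIndices n k => LpOn 𝕜 Ω p) where
  toFun u := WithLp.toLp 1 fun α => weakDeriv α u
  map_add' u v := by
    ext1 α
    exact (isWeakDeriv_weakDeriv α (u + v)).unique
      ((isWeakDeriv_weakDeriv α u).add (isWeakDeriv_weakDeriv α v))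
  map_smul' c u := by
    ext1 α
    exact (isWeakDeriv_weakDeriv α (c • u)).unique ((isWeakDeriv_weakDeriv α u).smul c)

theorem weakDeriv_zero (u : SobolevSpace 𝕜 Ω k p) :
    weakDeriv ⟨0, mem_multiIndices.2 (by simp)⟩ u = toLp u := by
  refine (isWeakDeriv_weakDeriv ⟨0, mem_multiIndices.2 (by simp)⟩ u).unique fun φ => ?_
  have : testDeriv 0 φ = φ := by
    unfold testDeriv
    induction List.finRange n with
    | nil => rfl
    | cons i l ih => simp
  simp [this]

theorem jet_injective :
    Function.Injective (jet : SobolevSpace 𝕜 Ω k p →ₗ[𝕜]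
      PiLp 1 (fun _ : multiIndices n k => LpOn 𝕜 Ω p)) := by
  intro u v h
  apply toLp_injective
  rw [← weakDeriv_zero u, ← weakDeriv_zero v]
  exact congrArg (fun f => f.ofLp ⟨0, mem_multiIndices.2 (by simp)⟩) h

instance : NormedAddCommGroup (SobolevSpace 𝕜 Ω k p) :=
  NormedAddCommGroup.induced _ _ jet jet_injective

instance : NormedSpace 𝕜 (SobolevSpace 𝕜 Ω k p) :=
  NormedSpace.induced 𝕜 _ _ jet

/-- The norm of `W^{k,p}(Ω)` is `‖u‖ = ∑_{|α| ≤ k} ‖∂^α u‖_{L^p(Ω)}`. -/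
theorem norm_def (u : SobolevSpace 𝕜 Ω k p) : ‖u‖ = ∑ α, ‖weakDeriv α u‖ := by
  change ‖jet u‖ = _
  rw [PiLp.norm_eq_of_L1]
  rfl

variable (𝕜 Ω k p) in
/-- `C₀^∞(Ω)` as a subspace of `W^{k,p}(Ω)`. -/
def testFunctions : Submodule 𝕜 (SobolevSpace 𝕜 Ω k p) where
  carrier := {u | ∃ φ : 𝓓(Ω, 𝕜),
    toLp u =ᵐ[volume.restrict (Ω : Set (EuclideanSpace ℝ (Fin n)))] φ}
  zero_mem' := ⟨0, by
    rw [map_zero]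
    filter_upwards [Lp.coeFn_zero 𝕜 p
      ((volume : Measure (EuclideanSpace ℝ (Fin n))).restrict Ω)] with x hx
    rw [hx]; rfl⟩
  add_mem' := by
    rintro u v ⟨φ, hφ⟩ ⟨ψ, hψ⟩
    refine ⟨φ + ψ, ?_⟩
    rw [map_add]
    filter_upwards [Lp.coeFn_add (toLp u) (toLp v), hφ, hψ] with x hx h1 h2
    rw [hx, Pi.add_apply, h1, h2]; rfl
  smul_mem' := by
    rintro c u ⟨φ, hφ⟩
    refine ⟨c • φ, ?_⟩
    rw [map_smul]
    filter_upwards [Lp.coeFn_smul c (toLp u), hφ] with x hx h1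
    rw [hx, Pi.smul_apply, h1]; rfl

end SobolevSpace

/-- `W̊^{k,p}(Ω)`, the closure of `C₀^∞(Ω)` in `W^{k,p}(Ω)`, with the norm of `W^{k,p}(Ω)`. -/
def SobolevSpaceZero (𝕜 : Type*) [RCLike 𝕜] {n : ℕ} (Ω : Opens (EuclideanSpace ℝ (Fin n)))
    (k : ℕ) (p : ℝ≥0∞) [Fact (1 ≤ p)] : Submodule 𝕜 (SobolevSpace 𝕜 Ω k p) :=
  (SobolevSpace.testFunctions 𝕜 Ω k p).topologicalClosure

/-- The inclusion `W̊^{k,p}(Ω) → L^p(Ω)`, `u ↦ u`. -/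
def SobolevSpaceZero.inclusion (𝕜 : Type*) [RCLike 𝕜] {n : ℕ}
    (Ω : Opens (EuclideanSpace ℝ (Fin n))) (k : ℕ) (p : ℝ≥0∞) [Fact (1 ≤ p)] :
    SobolevSpaceZero 𝕜 Ω k p →ₗ[𝕜] LpOn 𝕜 Ω p :=
  SobolevSpace.toLp ∘ₗ (SobolevSpaceZero 𝕜 Ω k p).subtype

end

/-! The inclusion is a limit, in operator norm, of finite rank operators, and a norm limit of
compact operators is compact. No regularity of the boundary is needed, because a test function
extends smoothly by zero to the whole space.

The approximating operator `gridProjection` replaces `u` by its averages over finitely many cells of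
the grid of mesh `1 / m`. For a test function `φ` the error has two parts. A Poincaré inequality on
the grid (`lintegral_enorm_sub_gridAverage_rpow_le`) bounds `φ` minus its average by a constant
times `‖∇φ‖_p / m`, and `‖∇φ‖_p ≤ n ‖u‖` since `k ≥ 1`. On the omitted cells the average is at most
`m ^ n ‖φ‖₁`, and Hölder's inequality on `Ω` bounds this by `m ^ n |Ω| ^ (1 - 1/p) ‖u‖_p`; its `L^p`
norm is small because the omitted part of `Ω` has small measure. The second part is where `|Ω| < ∞`
replaces boundedness of `Ω`. Both bounds are uniform in `φ`, so they pass to the closure of the test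
functions. -/

/-! ### Jensen's inequality and the translation estimate. -/

section GridAverage

/-- Jensen's inequality for powers and a probability measure. -/
theorem lintegral_rpow_le_lintegral_rpow {α : Type*} [MeasurableSpace α] {μ : Measure α}
    [IsProbabilityMeasure μ] {g : α → ℝ≥0∞} (hg : AEMeasurable g μ) {r : ℝ} (hr : 1 ≤ r) :
    (∫⁻ a, g a ∂μ) ^ r ≤ ∫⁻ a, g a ^ r ∂μ := by
  have h0 : 0 < r := by linarith
  have h := eLpNorm'_le_eLpNorm'_of_exponent_le one_pos hr μ hg.aestronglyMeasurable
  simp only [eLpNorm', enorm_eq_self, ENNReal.rpow_one, div_one] at h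
  have h' := ENNReal.rpow_le_rpow h h0.le
  rwa [← ENNReal.rpow_mul, one_div_mul_cancel h0.ne', ENNReal.rpow_one] at h'

variable {F : Type*} [NormedAddCommGroup F] [NormedSpace ℝ F]

/-- The `L^r` modulus of continuity of a `C¹` function is controlled by its gradient. -/
theorem lintegral_enorm_translate_sub_rpow_le {E : Type*} [NormedAddCommGroup E]
    [NormedSpace ℝ E] [MeasurableSpace E] [BorelSpace E] [SecondCountableTopology E]
    {μ : Measure E} [SFinite μ]
    [μ.IsAddRightInvariant] {f : E → F} (hf : ContDiff ℝ 1 f) {r : ℝ} (hr : 1 ≤ r) (h : E) :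
    ∫⁻ x, ‖f (x + h) - f x‖ₑ ^ r ∂μ ≤ ‖h‖ₑ ^ r * ∫⁻ x, ‖fderiv ℝ f x‖ₑ ^ r ∂μ := by
  have h0 : 0 ≤ r := by linarith
  have hD : Continuous fun x => ‖fderiv ℝ f x‖ₑ := (hf.continuous_fderiv one_ne_zero).enorm
  have : IsProbabilityMeasure (volume.restrict (Set.Icc (0 : ℝ) 1)) := ⟨by simp⟩
  -- The fundamental theorem of calculus along the segment from `x` to `x + h`, then Jensen in `t`.
  -- After integration in `x`, Tonelli and translation invariance remove the shift `t • h`.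
  have key : ∀ x, ‖f (x + h) - f x‖ₑ ^ r ≤
      ‖h‖ₑ ^ r * ∫⁻ t in Set.Icc (0 : ℝ) 1, ‖fderiv ℝ f (x + t • h)‖ₑ ^ r := by
    intro x
    have hc : ContDiff ℝ 1 fun t : ℝ => f (x + t • h) := by fun_prop
    have h1 := enorm_sub_le_lintegral_deriv_of_contDiffOn_Icc hc.contDiffOn
      (zero_le_one (α := ℝ))
    simp only [one_smul, zero_smul, add_zero] at h1
    have hm : Measurable fun t : ℝ => ‖fderiv ℝ f (x + t • h)‖ₑ :=
      (hD.comp (by fun_prop : Continuous fun t : ℝ => x + t • h)).measurable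
    calc ‖f (x + h) - f x‖ₑ ^ r
        ≤ (‖h‖ₑ * ∫⁻ t in Set.Icc (0 : ℝ) 1, ‖fderiv ℝ f (x + t • h)‖ₑ) ^ r := by
          refine ENNReal.rpow_le_rpow (h1.trans ?_) h0
          rw [← lintegral_const_mul _ hm]
          refine lintegral_mono fun t => ?_
          have hd : HasDerivAt (fun t : ℝ => f (x + t • h)) (fderiv ℝ f (x + t • h) h) t := by
            have hl : HasDerivAt (fun t : ℝ => x + t • h) h t := by
              simpa using ((hasDerivAt_id t).smul_const h).const_add x
            exact ((hf.differentiable one_ne_zero _).hasFDerivAt).comp_hasDerivAt t hl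
          rw [hd.deriv, mul_comm]
          exact ContinuousLinearMap.le_opENorm _ _
      _ ≤ _ := by
          rw [ENNReal.mul_rpow_of_nonneg _ _ h0]
          gcongr
          exact lintegral_rpow_le_lintegral_rpow hm.aemeasurable hr
  have hm2 : Measurable fun z : E × ℝ => ‖fderiv ℝ f (z.1 + z.2 • h)‖ₑ ^ r :=
    (hD.comp (by fun_prop : Continuous fun z : E × ℝ => z.1 + z.2 • h)).measurable.pow_const r
  calc ∫⁻ x, ‖f (x + h) - f x‖ₑ ^ r ∂μ
      ≤ ∫⁻ x, (‖h‖ₑ ^ r * ∫⁻ t in Set.Icc (0 : ℝ) 1, ‖fderiv ℝ f (x + t • h)‖ₑ ^ r) ∂μ :=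
        lintegral_mono key
    _ = ‖h‖ₑ ^ r * ∫⁻ t in Set.Icc (0 : ℝ) 1, ∫⁻ x, ‖fderiv ℝ f (x + t • h)‖ₑ ^ r ∂μ := by
        rw [lintegral_const_mul _ hm2.lintegral_prod_right', lintegral_lintegral_swap]
        exact hm2.aemeasurable
    _ = _ := by
        have : ∀ t : ℝ, ∫⁻ x, ‖fderiv ℝ f (x + t • h)‖ₑ ^ r ∂μ
            = ∫⁻ x, ‖fderiv ℝ f x‖ₑ ^ r ∂μ := fun t =>
          lintegral_add_right_eq_self (fun x => ‖fderiv ℝ f x‖ₑ ^ r) (t • h)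
        simp [this]

/-! ### Grid cells, averages and the Poincaré inequality. -/

variable {n : ℕ}

/-- The index of the cell of the grid of mesh `1 / m` that contains `x`. -/
noncomputable def gridIndex (m : ℕ) (x : EuclideanSpace ℝ (Fin n)) : Fin n → ℤ :=
  fun i => ⌊(m : ℝ) * x i⌋

/-- The cell with index `j` of the grid of mesh `1 / m`. -/
def gridCell (m : ℕ) (j : Fin n → ℤ) : Set (EuclideanSpace ℝ (Fin n)) :=
  gridIndex m ⁻¹' {j}

theorem measurable_gridIndex (m : ℕ) :
    Measurable (gridIndex m : EuclideanSpace ℝ (Fin n) → Fin n → ℤ) := by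
  refine measurable_pi_iff.2 fun i => Int.measurable_floor.comp ?_
  exact (by fun_prop : Continuous fun x : EuclideanSpace ℝ (Fin n) => (m : ℝ) * x i).measurable

theorem measurableSet_gridCell (m : ℕ) (j : Fin n → ℤ) : MeasurableSet (gridCell m j) :=
  measurable_gridIndex m (measurableSet_singleton j)

theorem volume_gridCell {m : ℕ} (hm : 0 < m) (j : Fin n → ℤ) :
    volume (gridCell m j) = ENNReal.ofReal (1 / m) ^ n := by
  have hm' : (0 : ℝ) < m := by exact_mod_cast hm
  have e : gridCell m j = (WithLp.ofLp : EuclideanSpace ℝ (Fin n) → Fin n → ℝ) ⁻¹'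
      (Set.univ.pi fun i => Set.Ico ((j i : ℝ) / m) ((j i + 1) / m)) := by
    ext x
    simp only [gridCell, gridIndex, Set.mem_preimage, Set.mem_singleton_iff, funext_iff,
      Set.mem_univ_pi, Set.mem_Ico, Int.floor_eq_iff, div_le_iff₀ hm', lt_div_iff₀ hm',
      mul_comm (m : ℝ)]
  rw [e, (PiLp.volume_preserving_ofLp (Fin n)).measure_preimage
    (MeasurableSet.univ_pi fun i => measurableSet_Ico).nullMeasurableSet, Real.volume_pi_Ico]
  have : ∀ i, ((j i : ℝ) + 1) / m - j i / m = 1 / m := fun i => by ring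
  simp [this]

/-- The open cube with centre `0` and side `2 / m`. -/
def gridNhd (n m : ℕ) : Set (EuclideanSpace ℝ (Fin n)) :=
  WithLp.ofLp ⁻¹' (Set.univ.pi fun _ => Set.Ioo (-(1 / m : ℝ)) (1 / m))

theorem measurableSet_gridNhd (m : ℕ) : MeasurableSet (gridNhd n m) :=
  (PiLp.volume_preserving_ofLp (Fin n)).measurable
    (MeasurableSet.univ_pi fun _ => measurableSet_Ioo)

theorem volume_gridNhd (m : ℕ) :
    volume (gridNhd n m) = 2 ^ n * ENNReal.ofReal (1 / m) ^ n := by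
  rw [gridNhd, (PiLp.volume_preserving_ofLp (Fin n)).measure_preimage
    (MeasurableSet.univ_pi fun _ => measurableSet_Ioo).nullMeasurableSet, Real.volume_pi_Ioo]
  have : (1 / m : ℝ) - -(1 / m) = 2 * (1 / m) := by ring
  rw [this, ENNReal.ofReal_mul zero_le_two]
  simp [mul_pow]

theorem EuclideanSpace.norm_le_sum_abs (x : EuclideanSpace ℝ (Fin n)) :
    ‖x‖ ≤ ∑ i, |x i| := by
  rw [EuclideanSpace.norm_eq]
  refine Real.sqrt_le_iff.2 ⟨by positivity, ?_⟩
  simpa using Finset.sum_sq_le_sq_sum_of_nonneg (s := Finset.univ) (f := fun i => |x i|) (fun i _ => abs_nonneg _)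

theorem norm_le_of_mem_gridNhd {m : ℕ} {h : EuclideanSpace ℝ (Fin n)} (hh : h ∈ gridNhd n m) :
    ‖h‖ ≤ n / m := by
  refine (EuclideanSpace.norm_le_sum_abs h).trans ?_
  calc ∑ i, |h i| ≤ ∑ _i : Fin n, (1 / m : ℝ) :=
        Finset.sum_le_sum fun i _ => (abs_lt.2 (hh i trivial)).le
    _ = n / m := by simp [div_eq_mul_inv]

/-- Reals with equal floors differ by less than one. A cell thus lies in a translate of one fixed
cube, which does not depend on the cell; this makes the later exchange of integrals possible. -/
theorem sub_mem_gridNhd {m : ℕ} (hm : 0 < m) {x y : EuclideanSpace ℝ (Fin n)}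
    (h : gridIndex m y = gridIndex m x) : y - x ∈ gridNhd n m := by
  have hm' : (0 : ℝ) < m := by exact_mod_cast hm
  intro i _
  have h1 := Int.abs_sub_lt_one_of_floor_eq_floor (congrFun h i)
  rw [← mul_sub, abs_mul, abs_of_pos hm', mul_comm, ← lt_div_iff₀ hm'] at h1
  exact abs_lt.1 h1

/-- The average of `f` over the grid cell that contains `x`. -/
noncomputable def gridAverage (m : ℕ) (f : EuclideanSpace ℝ (Fin n) → F)
    (x : EuclideanSpace ℝ (Fin n)) : F :=
  ⨍ y in gridCell m (gridIndex m x), f y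

/-- The average depends on `x` only through its index, which lives in a discrete space. -/
theorem stronglyMeasurable_gridAverage (m : ℕ) (f : EuclideanSpace ℝ (Fin n) → F) :
    StronglyMeasurable (gridAverage m f) :=
  (StronglyMeasurable.of_discrete (f := fun j => ⨍ y in gridCell m j, f y)).comp_measurable
    (measurable_gridIndex m)

theorem volume_gridCell_ne_zero {m : ℕ} (hm : 0 < m) (j : Fin n → ℤ) :
    volume (gridCell m j) ≠ 0 := by
  have hm' : (0 : ℝ) < m := by exact_mod_cast hm
  rw [volume_gridCell hm]
  exact pow_ne_zero _ (ENNReal.ofReal_pos.2 (by positivity)).ne'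

theorem volume_gridCell_ne_top {m : ℕ} (hm : 0 < m) (j : Fin n → ℤ) :
    volume (gridCell m j) ≠ ∞ := by
  rw [volume_gridCell hm]
  exact ENNReal.pow_ne_top ENNReal.ofReal_ne_top

/-- A crude uniform bound that degenerates as `m` grows; it serves only on the omitted cells, with
`m` fixed. -/
theorem enorm_gridAverage_le {m : ℕ} (hm : 0 < m) (f : EuclideanSpace ℝ (Fin n) → F)
    (x : EuclideanSpace ℝ (Fin n)) :
    ‖gridAverage m f x‖ₑ ≤ (ENNReal.ofReal (1 / m) ^ n)⁻¹ * ∫⁻ y, ‖f y‖ₑ := by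
  refine (enorm_integral_le_lintegral_enorm _).trans ?_
  rw [lintegral_smul_measure, Measure.restrict_apply_univ, volume_gridCell hm, smul_eq_mul]
  gcongr
  exact Measure.restrict_le_self

/-- The difference is the mean of `f x - f y` over the cell, to which Jensen applies. -/
theorem enorm_sub_gridAverage_rpow_le [CompleteSpace F] {m : ℕ} (hm : 0 < m)
    {f : EuclideanSpace ℝ (Fin n) → F} (hf : Continuous f) (hfi : Integrable f)
    {r : ℝ} (hr : 1 ≤ r) (x : EuclideanSpace ℝ (Fin n)) :
    ‖f x - gridAverage m f x‖ₑ ^ r ≤ (ENNReal.ofReal (1 / m) ^ n)⁻¹ *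
      ∫⁻ h in gridNhd n m, ‖f (x + h) - f x‖ₑ ^ r := by
  have h0 : 0 ≤ r := by linarith
  set Q := gridCell m (gridIndex m x) with hQ
  have hQm : MeasurableSet Q := measurableSet_gridCell _ _
  set ν : Measure (EuclideanSpace ℝ (Fin n)) := (volume Q)⁻¹ • volume.restrict Q with hν
  have hνp : IsProbabilityMeasure ν := ⟨by
    simp [hν, ENNReal.inv_mul_cancel (volume_gridCell_ne_zero hm _)
      (volume_gridCell_ne_top hm _), hQ]⟩
  have hνi : Integrable f ν := hfi.integrableOn.smul_measure
    (ENNReal.inv_ne_top.2 (volume_gridCell_ne_zero hm _))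
  have e : f x - gridAverage m f x = ∫ y, (f x - f y) ∂ν := by
    rw [integral_sub (integrable_const _) hνi]
    simp [gridAverage, average, hν, hQ]
  have hmeas : Measurable fun y => ‖f x - f y‖ₑ :=
    (by fun_prop : Continuous fun y => f x - f y).enorm.measurable
  calc ‖f x - gridAverage m f x‖ₑ ^ r
      ≤ (∫⁻ y, ‖f x - f y‖ₑ ∂ν) ^ r := by
        rw [e]
        exact ENNReal.rpow_le_rpow (enorm_integral_le_lintegral_enorm _) h0
    _ ≤ ∫⁻ y, ‖f x - f y‖ₑ ^ r ∂ν := lintegral_rpow_le_lintegral_rpow hmeas.aemeasurable hr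
    _ = (ENNReal.ofReal (1 / m) ^ n)⁻¹ * ∫⁻ y in Q, ‖f x - f y‖ₑ ^ r := by
        rw [hν, lintegral_smul_measure, volume_gridCell hm, smul_eq_mul]
    _ ≤ _ := by
        -- Substitute `y = x + h` and enlarge the domain from the shifted cell to `gridNhd n m`.
        refine mul_le_mul' le_rfl ?_
        rw [← lintegral_indicator hQm, ← lintegral_indicator (measurableSet_gridNhd m),
          ← lintegral_add_left_eq_self _ x]
        refine lintegral_mono fun h => ?_
        by_cases hh : x + h ∈ Q
        · have : h ∈ gridNhd n m := by
            simpa using sub_mem_gridNhd hm (x := x) (y := x + h) hh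
          rw [Set.indicator_of_mem hh, Set.indicator_of_mem this, ← enorm_neg, neg_sub]
        · simp [Set.indicator_of_notMem hh]

/-- A Poincaré inequality on the grid of mesh `1 / m`. -/
theorem lintegral_enorm_sub_gridAverage_rpow_le [CompleteSpace F] {m : ℕ} (hm : 0 < m)
    {f : EuclideanSpace ℝ (Fin n) → F} (hf : ContDiff ℝ 1 f) (hfi : Integrable f)
    {r : ℝ} (hr : 1 ≤ r) :
    ∫⁻ x, ‖f x - gridAverage m f x‖ₑ ^ r ≤
      2 ^ n * (ENNReal.ofReal (n / m) ^ r * ∫⁻ x, ‖fderiv ℝ f x‖ₑ ^ r) := by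
  have h0 : 0 ≤ r := by linarith
  have hc := hf.continuous
  have hm2 : Measurable fun z : EuclideanSpace ℝ (Fin n) × EuclideanSpace ℝ (Fin n) =>
      ‖f (z.1 + z.2) - f z.1‖ₑ ^ r :=
    (by fun_prop : Continuous fun z : EuclideanSpace ℝ (Fin n) × EuclideanSpace ℝ (Fin n) =>
      f (z.1 + z.2) - f z.1).enorm.measurable.pow_const r
  have hV0 : ENNReal.ofReal (1 / m) ^ n ≠ 0 := by
    rw [← volume_gridCell hm 0]; exact volume_gridCell_ne_zero hm 0
  have hVt : ENNReal.ofReal (1 / m) ^ n ≠ ∞ := ENNReal.pow_ne_top ENNReal.ofReal_ne_top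
  calc ∫⁻ x, ‖f x - gridAverage m f x‖ₑ ^ r
      ≤ ∫⁻ x, (ENNReal.ofReal (1 / m) ^ n)⁻¹ *
        ∫⁻ h in gridNhd n m, ‖f (x + h) - f x‖ₑ ^ r :=
        lintegral_mono (enorm_sub_gridAverage_rpow_le hm hc hfi hr)
    _ = (ENNReal.ofReal (1 / m) ^ n)⁻¹ *
        ∫⁻ h in gridNhd n m, ∫⁻ x, ‖f (x + h) - f x‖ₑ ^ r := by
        rw [lintegral_const_mul _ hm2.lintegral_prod_right', lintegral_lintegral_swap]
        exact hm2.aemeasurable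
    _ ≤ (ENNReal.ofReal (1 / m) ^ n)⁻¹ *
        ∫⁻ h in gridNhd n m, (ENNReal.ofReal (n / m) ^ r * ∫⁻ x, ‖fderiv ℝ f x‖ₑ ^ r) := by
        refine mul_le_mul' le_rfl ?_
        refine setLIntegral_mono measurable_const fun h hh => ?_
        refine (lintegral_enorm_translate_sub_rpow_le hf hr h).trans ?_
        gcongr
        rw [← ofReal_norm]
        exact ENNReal.ofReal_le_ofReal (norm_le_of_mem_gridNhd hh)
    _ = _ := by
        -- The factor `2 ^ n` is the ratio of the volumes of the cube `gridNhd n m` and a cell.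
        rw [setLIntegral_const, volume_gridNhd, mul_comm _ (2 ^ n * _), mul_assoc,
          ← mul_assoc, ← mul_assoc, mul_comm _ (2 ^ n : ℝ≥0∞), mul_assoc (2 ^ n : ℝ≥0∞),
          ENNReal.inv_mul_cancel hV0 hVt, mul_one]

end GridAverage

/-! ### The Poincaré inequality in `L^p` norms, and gradients versus partial derivatives. -/

section GridAverageLp

variable {F : Type*} [NormedAddCommGroup F] [NormedSpace ℝ F] {n : ℕ}

theorem eLpNorm_sub_gridAverage_le [CompleteSpace F] {m : ℕ} (hm : 0 < m)
    {f : EuclideanSpace ℝ (Fin n) → F} (hf : ContDiff ℝ 1 f) (hfi : Integrable f)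
    {p : ℝ≥0∞} (hp1 : 1 ≤ p) (hp : p ≠ ∞) :
    eLpNorm (f - gridAverage m f) p volume ≤
      ((2 : ℝ≥0∞) ^ n) ^ (1 / p.toReal) * ENNReal.ofReal (n / m) *
        eLpNorm (fderiv ℝ f) p volume := by
  have hp0 : p ≠ 0 := (zero_lt_one.trans_le hp1).ne'
  have hr : 1 ≤ p.toReal := by simpa using ENNReal.toReal_mono hp hp1
  have hr0 : 0 < p.toReal := by linarith
  rw [eLpNorm_eq_lintegral_rpow_enorm_toReal hp0 hp, eLpNorm_eq_lintegral_rpow_enorm_toReal hp0 hp]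
  refine (ENNReal.rpow_le_rpow (lintegral_enorm_sub_gridAverage_rpow_le hm hf hfi hr)
    (by positivity)).trans_eq ?_
  rw [ENNReal.mul_rpow_of_nonneg _ _ (by positivity), ENNReal.mul_rpow_of_nonneg _ _ (by positivity),
    ← ENNReal.rpow_mul, mul_one_div_cancel hr0.ne', ENNReal.rpow_one, mul_assoc]

theorem EuclideanSpace.opNorm_le_sum_norm_single (L : EuclideanSpace ℝ (Fin n) →L[ℝ] F) :
    ‖L‖ ≤ ∑ i, ‖L (EuclideanSpace.single i 1)‖ := by
  refine L.opNorm_le_bound (by positivity) fun x => ?_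
  have hx : x = ∑ i, x i • EuclideanSpace.single i (1 : ℝ) := by
    ext j
    simp [Finset.sum_apply, Pi.single_apply]
  conv_lhs => rw [hx]
  rw [map_sum, Finset.sum_mul]
  refine (norm_sum_le _ _).trans (Finset.sum_le_sum fun i _ => ?_)
  rw [map_smul, norm_smul, mul_comm]
  gcongr
  exact PiLp.norm_apply_le x i

theorem eLpNorm_fderiv_le_sum {f : EuclideanSpace ℝ (Fin n) → F} (hf : ContDiff ℝ 1 f)
    {p : ℝ≥0∞} (hp1 : 1 ≤ p) (μ : Measure (EuclideanSpace ℝ (Fin n))) :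
    eLpNorm (fderiv ℝ f) p μ ≤
      ∑ i, eLpNorm (fun x => fderiv ℝ f x (EuclideanSpace.single i 1)) p μ := by
  have hc : ∀ i : Fin n, Continuous fun x => fderiv ℝ f x (EuclideanSpace.single i 1) := fun i =>
    (hf.continuous_fderiv one_ne_zero).clm_apply continuous_const
  calc eLpNorm (fderiv ℝ f) p μ
      ≤ eLpNorm (∑ i, fun x => ‖fderiv ℝ f x (EuclideanSpace.single i 1)‖) p μ := by
        refine eLpNorm_mono_real fun x => ?_
        simpa using EuclideanSpace.opNorm_le_sum_norm_single (fderiv ℝ f x)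
    _ ≤ ∑ i, eLpNorm (fun x => ‖fderiv ℝ f x (EuclideanSpace.single i 1)‖) p μ :=
        eLpNorm_sum_le (fun i _ => (hc i).norm.measurable.aestronglyMeasurable) hp1
    _ = _ := by simp only [eLpNorm_norm]

end GridAverageLp

/-! ### Classical derivatives of test functions as weak derivatives. -/

section TestFunctions

variable {𝕜 : Type*} [RCLike 𝕜] {n : ℕ} {Ω : Opens (EuclideanSpace ℝ (Fin n))}

theorem testDeriv_single (i : Fin n) (φ : 𝓓(Ω, 𝕜)) :
    testDeriv (Pi.single i 1) φ = ∂_{EuclideanSpace.single i (1 : ℝ)} φ := by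
  -- Generalised to any list without repetition for the induction: the factor at `i` acts at most
  -- once, and all others are zeroth iterates.
  have key : ∀ l : List (Fin n), l.Nodup → l.foldr
      (fun j ψ => (fun η : 𝓓(Ω, 𝕜) =>
        ∂_{EuclideanSpace.single j (1 : ℝ)} η)^[(Pi.single i 1 : Fin n → ℕ) j] ψ) φ =
      if i ∈ l then ∂_{EuclideanSpace.single i (1 : ℝ)} φ else φ := by
    intro l
    induction l with
    | nil => simp
    | cons j l ih =>
      intro hl
      rw [List.nodup_cons] at hl
      rw [List.foldr_cons, ih hl.2]
      rcases eq_or_ne i j with rfl | hij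
      · simp [hl.1]
      · simp [hij]
  rw [testDeriv, key _ (List.nodup_finRange n), if_pos (List.mem_finRange i)]

theorem lineDerivOp_apply (v : EuclideanSpace ℝ (Fin n)) (φ : 𝓓(Ω, 𝕜))
    (x : EuclideanSpace ℝ (Fin n)) : (∂_{v} φ) x = fderiv ℝ φ x v := by
  have h := TestFunction.lineDerivCLM_apply_of_le (𝕜 := ℝ) (k := ⊤) (f := φ) (v := v) (x := x) le_top
  exact h.trans (φ.contDiff.differentiable (by simp) x).lineDeriv_eq_fderiv

theorem TestFunction.support_subset (φ : 𝓓(Ω, 𝕜)) :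
    Function.support φ ⊆ (Ω : Set (EuclideanSpace ℝ (Fin n))) :=
  (subset_tsupport _).trans φ.tsupport_subset

theorem TestFunction.memLp (φ : 𝓓(Ω, 𝕜)) (p : ℝ≥0∞) :
    MemLp φ p (volume.restrict (Ω : Set (EuclideanSpace ℝ (Fin n)))) :=
  (φ.continuous.memLp_of_hasCompactSupport φ.hasCompactSupport).restrict _

/-- Both products vanish off `Ω`, so this is integration by parts on the whole space, without
boundary terms. -/
theorem integral_mul_lineDerivOp (v : EuclideanSpace ℝ (Fin n)) (φ ψ : 𝓓(Ω, 𝕜)) :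
    ∫ x in (Ω : Set (EuclideanSpace ℝ (Fin n))), φ x * (∂_{v} ψ) x =
      -∫ x in (Ω : Set (EuclideanSpace ℝ (Fin n))), (∂_{v} φ) x * ψ x := by
  have hφ : ∀ x ∉ (Ω : Set (EuclideanSpace ℝ (Fin n))), φ x = 0 := fun x hx =>
    Function.notMem_support.1 fun h => hx (TestFunction.support_subset φ h)
  have hψ : ∀ x ∉ (Ω : Set (EuclideanSpace ℝ (Fin n))), ψ x = 0 := fun x hx =>
    Function.notMem_support.1 fun h => hx (TestFunction.support_subset ψ h)
  have hint : ∀ η θ : 𝓓(Ω, 𝕜), Integrable fun x => η x * θ x := fun η θ =>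
    (η.continuous.mul θ.continuous).integrable_of_hasCompactSupport
      (η.hasCompactSupport.mul_right)
  rw [setIntegral_eq_integral_of_forall_compl_eq_zero (fun x hx => by rw [hφ x hx, zero_mul]),
    setIntegral_eq_integral_of_forall_compl_eq_zero (fun x hx => by rw [hψ x hx, mul_zero])]
  have h1 := hint φ (∂_{v} ψ)
  have h2 := hint (∂_{v} φ) ψ
  simp only [lineDerivOp_apply] at h1 h2 ⊢
  exact integral_mul_fderiv_eq_neg_fderiv_mul_of_integrable h2 h1 (hint φ ψ)
    (fun x _ => φ.contDiff.differentiable (by simp) x)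
    (fun x _ => ψ.contDiff.differentiable (by simp) x)

theorem isWeakDeriv_single_of_ae_eq {p : ℝ≥0∞} {u v : LpOn 𝕜 Ω p} {φ : 𝓓(Ω, 𝕜)} {i : Fin n}
    (hu : u =ᵐ[volume.restrict (Ω : Set (EuclideanSpace ℝ (Fin n)))] φ)
    (hv : v =ᵐ[volume.restrict (Ω : Set (EuclideanSpace ℝ (Fin n)))]
      (∂_{EuclideanSpace.single i (1 : ℝ)} φ : 𝓓(Ω, 𝕜))) :
    IsWeakDeriv (Pi.single i 1) u v := by
  intro ψ
  have h1 : ∫ x in (Ω : Set (EuclideanSpace ℝ (Fin n))), u x * testDeriv (Pi.single i 1) ψ x =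
      ∫ x in (Ω : Set (EuclideanSpace ℝ (Fin n))),
        φ x * (∂_{EuclideanSpace.single i (1 : ℝ)} ψ) x := by
    rw [testDeriv_single]
    refine integral_congr_ae ?_
    filter_upwards [hu] with x hx
    rw [hx]
  have h2 : ∫ x in (Ω : Set (EuclideanSpace ℝ (Fin n))), v x * ψ x =
      ∫ x in (Ω : Set (EuclideanSpace ℝ (Fin n))),
        (∂_{EuclideanSpace.single i (1 : ℝ)} φ) x * ψ x := by
    refine integral_congr_ae ?_
    filter_upwards [hv] with x hx
    rw [hx]
  rw [h1, h2, integral_mul_lineDerivOp]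
  simp

end TestFunctions

/-! ### Bounds by the Sobolev norm. -/

namespace SobolevSpace

variable {𝕜 : Type*} [RCLike 𝕜] {n : ℕ} {Ω : Opens (EuclideanSpace ℝ (Fin n))}
  {k : ℕ} {p : ℝ≥0∞} [Fact (1 ≤ p)]

theorem norm_weakDeriv_le (α : multiIndices n k) (u : SobolevSpace 𝕜 Ω k p) :
    ‖weakDeriv α u‖ ≤ ‖u‖ := by
  rw [norm_def]
  exact Finset.single_le_sum (f := fun α => ‖weakDeriv α u‖) (fun _ _ => norm_nonneg _)
    (Finset.mem_univ α)

theorem norm_toLp_le (u : SobolevSpace 𝕜 Ω k p) : ‖toLp u‖ ≤ ‖u‖ := by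
  rw [← weakDeriv_zero u]
  exact norm_weakDeriv_le _ u

variable (𝕜 Ω k p) in
/-- The inclusion of `W^{k,p}(Ω)` into `L^p(Ω)` as a continuous linear map. -/
noncomputable def toLpCLM : SobolevSpace 𝕜 Ω k p →L[𝕜] LpOn 𝕜 Ω p :=
  LinearMap.mkContinuous (toLp : SobolevSpace 𝕜 Ω k p →ₗ[𝕜] LpOn 𝕜 Ω p) 1 fun u =>
    (norm_toLp_le u).trans (one_mul ‖u‖).ge

/-- `weakDeriv` is obtained by choice; uniqueness identifies it with the classical partial
derivative of `φ`. Each of the `n` partial derivatives then contributes at most `‖u‖ₑ`. -/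
theorem eLpNorm_fderiv_le (hk : 1 ≤ k) {u : SobolevSpace 𝕜 Ω k p} {φ : 𝓓(Ω, 𝕜)}
    (hu : toLp u =ᵐ[volume.restrict (Ω : Set (EuclideanSpace ℝ (Fin n)))] φ) :
    eLpNorm (fderiv ℝ φ) p volume ≤ n * ‖u‖ₑ := by
  refine (eLpNorm_fderiv_le_sum (φ.contDiff.of_le (by simp)) Fact.out volume).trans ?_
  have key : ∀ i : Fin n,
      eLpNorm (fun x => fderiv ℝ φ x (EuclideanSpace.single i 1)) p volume ≤ ‖u‖ₑ := by
    intro i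
    have hα : Pi.single i 1 ∈ multiIndices n k := mem_multiIndices.2 (by simpa using hk)
    set ψ : 𝓓(Ω, 𝕜) := ∂_{EuclideanSpace.single i (1 : ℝ)} φ with hψ
    have hv := (TestFunction.memLp ψ p).coeFn_toLp
    have hw : weakDeriv ⟨_, hα⟩ u = (TestFunction.memLp ψ p).toLp ψ :=
      (isWeakDeriv_weakDeriv ⟨_, hα⟩ u).unique (isWeakDeriv_single_of_ae_eq hu hv)
    have e : (fun x => fderiv ℝ φ x (EuclideanSpace.single i 1)) = ψ :=
      funext fun x => (lineDerivOp_apply _ φ x).symm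
    rw [e, ← eLpNorm_restrict_eq_of_support_subset (TestFunction.support_subset ψ),
      ← Lp.enorm_toLp (TestFunction.memLp ψ p), ← hw, ← ofReal_norm, ← ofReal_norm]
    exact ENNReal.ofReal_le_ofReal (norm_weakDeriv_le _ u)
  exact (Finset.sum_le_sum fun i _ => key i).trans_eq (by simp)

end SobolevSpace

/-! ### The finite rank approximation and its error. -/

section GridProjection

open Filter Topology

variable {𝕜 : Type*} [RCLike 𝕜] {n : ℕ} {Ω : Opens (EuclideanSpace ℝ (Fin n))} {p : ℝ≥0∞}

theorem lintegral_enorm_le_eLpNorm_mul {α G : Type*} [MeasurableSpace α] {μ : Measure α}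
    [NormedAddCommGroup G] {f : α → G} (hp : 1 ≤ p) (hf : AEStronglyMeasurable f μ) :
    ∫⁻ x, ‖f x‖ₑ ∂μ ≤ eLpNorm f p μ * μ Set.univ ^ (1 - 1 / p.toReal) := by
  simpa [eLpNorm_one_eq_lintegral_enorm] using eLpNorm_le_eLpNorm_mul_rpow_measure_univ hp hf

theorem one_sub_one_div_toReal_nonneg (hp1 : 1 ≤ p) : 0 ≤ 1 - 1 / p.toReal := by
  -- Since `∞.toReal = 0` and `1 / 0 = 0`, the exponent at `p = ∞` is `1`.
  rcases eq_or_ne p ∞ with rfl | hp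
  · simp
  · have hr : 1 ≤ p.toReal := by simpa using ENNReal.toReal_mono hp hp1
    rw [sub_nonneg]
    exact div_le_one_of_le₀ hr (by linarith)

variable [Fact (1 ≤ p)] [IsFiniteMeasure (volume.restrict (Ω : Set (EuclideanSpace ℝ (Fin n))))]

theorem LpOn.integrable (u : LpOn 𝕜 Ω p) :
    Integrable u (volume.restrict (Ω : Set (EuclideanSpace ℝ (Fin n)))) :=
  (Lp.memLp u).integrable Fact.out

variable (𝕜 Ω p) in
/-- Integration over a subset of `Ω`, as a continuous linear functional on `L^p(Ω)`. -/
noncomputable def LpOn.setIntegralCLM (s : Set (EuclideanSpace ℝ (Fin n))) :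
    LpOn 𝕜 Ω p →L[𝕜] 𝕜 :=
  LinearMap.mkContinuous
    { toFun := fun u => ∫ x in s, u x ∂(volume.restrict (Ω : Set (EuclideanSpace ℝ (Fin n))))
      map_add' := fun u v => by
        rw [← integral_add (LpOn.integrable u).integrableOn (LpOn.integrable v).integrableOn]
        exact integral_congr_ae (ae_restrict_of_ae (Lp.coeFn_add u v))
      map_smul' := fun c u => by
        rw [RingHom.id_apply, ← integral_smul]
        exact integral_congr_ae (ae_restrict_of_ae (Lp.coeFn_smul c u)) }
    (volume.restrict (Ω : Set (EuclideanSpace ℝ (Fin n))) Set.univ ^ (1 - 1 / p.toReal)).toReal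
    fun u => by
      have h : ‖∫ x in s, u x ∂(volume.restrict (Ω : Set (EuclideanSpace ℝ (Fin n))))‖ₑ ≤
          volume.restrict (Ω : Set (EuclideanSpace ℝ (Fin n))) Set.univ ^ (1 - 1 / p.toReal) *
            ‖u‖ₑ := by
        refine (enorm_integral_le_lintegral_enorm _).trans ((setLIntegral_le_lintegral _ _).trans ?_)
        rw [mul_comm, Lp.enorm_def]
        exact lintegral_enorm_le_eLpNorm_mul Fact.out (Lp.aestronglyMeasurable u)
      have hC : volume.restrict (Ω : Set (EuclideanSpace ℝ (Fin n))) Set.univ ^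
          (1 - 1 / p.toReal) ≠ ∞ :=
        ENNReal.rpow_ne_top_of_nonneg (one_sub_one_div_toReal_nonneg Fact.out)
          (measure_ne_top _ _)
      have h' := ENNReal.toReal_mono (ENNReal.mul_ne_top hC enorm_ne_top) h
      simpa [ENNReal.toReal_mul] using h'

theorem LpOn.setIntegralCLM_apply (s : Set (EuclideanSpace ℝ (Fin n))) (u : LpOn 𝕜 Ω p) :
    LpOn.setIntegralCLM 𝕜 Ω p s u =
      ∫ x in s, u x ∂(volume.restrict (Ω : Set (EuclideanSpace ℝ (Fin n)))) := rfl

variable (𝕜 Ω p) in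
/-- The finite rank operator that averages `u`, extended by zero, over the grid cells with index
in `J`. -/
noncomputable def gridProjection (m : ℕ) (J : Finset (Fin n → ℤ)) : LpOn 𝕜 Ω p →L[𝕜] LpOn 𝕜 Ω p :=
  ∑ j ∈ J, (LpOn.setIntegralCLM 𝕜 Ω p (gridCell m j)).smulRight
    (indicatorConstLp p (measurableSet_gridCell m j) (measure_ne_top _ _)
      (((volume (gridCell m j)).toReal⁻¹ : ℝ) : 𝕜))

/-- Each summand factors through the locally compact field `𝕜`. -/
theorem isCompactOperator_gridProjection (m : ℕ) (J : Finset (Fin n → ℤ)) :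
    IsCompactOperator (gridProjection 𝕜 Ω p m J) := by
  change gridProjection 𝕜 Ω p m J ∈ compactOperator (RingHom.id 𝕜) (LpOn 𝕜 Ω p) (LpOn 𝕜 Ω p)
  refine Submodule.sum_mem _ fun j _ => ?_
  exact (isCompactOperator_of_locallyCompactSpace_dom
    (LpOn.setIntegralCLM 𝕜 Ω p (gridCell m j))).clm_comp
      ((ContinuousLinearMap.id 𝕜 𝕜).smulRight _)

/-- The functional sees only the part of a cell inside `Ω`, while the coefficient divides by the
volume of the whole cell. As `φ` vanishes off `Ω`, the outcome is the average of the zero extension.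
-/
theorem gridProjection_ae_eq {u : LpOn 𝕜 Ω p} {φ : 𝓓(Ω, 𝕜)}
    (hu : u =ᵐ[volume.restrict (Ω : Set (EuclideanSpace ℝ (Fin n)))] φ)
    (m : ℕ) (J : Finset (Fin n → ℤ)) :
    gridProjection 𝕜 Ω p m J u =ᵐ[volume.restrict (Ω : Set (EuclideanSpace ℝ (Fin n)))]
      (gridIndex m ⁻¹' (J : Set (Fin n → ℤ))).indicator (gridAverage m φ) := by
  have hI : ∀ j, LpOn.setIntegralCLM 𝕜 Ω p (gridCell m j) u = ∫ x in gridCell m j, φ x := by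
    intro j
    rw [LpOn.setIntegralCLM_apply, integral_congr_ae (ae_restrict_of_ae hu),
      Measure.restrict_restrict (measurableSet_gridCell m j)]
    refine (setIntegral_eq_of_subset_of_forall_sdiff_eq_zero (measurableSet_gridCell m j)
      Set.inter_subset_left fun x hx => ?_).symm
    exact Function.notMem_support.1 fun h =>
      hx.2 ⟨hx.1, TestFunction.support_subset φ h⟩
  have e : gridProjection 𝕜 Ω p m J u = ∑ j ∈ J, (∫ x in gridCell m j, φ x) •
      indicatorConstLp p (measurableSet_gridCell m j)
        (measure_ne_top (volume.restrict (Ω : Set (EuclideanSpace ℝ (Fin n)))) _)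
        (((volume (gridCell m j)).toReal⁻¹ : ℝ) : 𝕜) := by
    simp [gridProjection, hI]
  rw [e]
  have h1 : ∀ j : Fin n → ℤ, ((∫ x in gridCell m j, φ x) •
      indicatorConstLp p (measurableSet_gridCell m j)
        (measure_ne_top (volume.restrict (Ω : Set (EuclideanSpace ℝ (Fin n)))) _)
        (((volume (gridCell m j)).toReal⁻¹ : ℝ) : 𝕜) : LpOn 𝕜 Ω p)
      =ᵐ[volume.restrict (Ω : Set (EuclideanSpace ℝ (Fin n)))]
      (gridCell m j).indicator fun _ => ⨍ x in gridCell m j, φ x := by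
    intro j
    filter_upwards [Lp.coeFn_smul (∫ x in gridCell m j, φ x)
      (indicatorConstLp p (measurableSet_gridCell m j)
        (measure_ne_top (volume.restrict (Ω : Set (EuclideanSpace ℝ (Fin n)))) _)
        (((volume (gridCell m j)).toReal⁻¹ : ℝ) : 𝕜)),
      indicatorConstLp_coeFn (p := p) (hs := measurableSet_gridCell m j)
        (hμs := measure_ne_top (volume.restrict (Ω : Set (EuclideanSpace ℝ (Fin n)))) _)
        (c := (((volume (gridCell m j)).toReal⁻¹ : ℝ) : 𝕜))] with x hx hx'
    rw [hx, Pi.smul_apply, hx', setAverage_eq, measureReal_def, RCLike.real_smul_eq_coe_mul,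
      smul_eq_mul]
    by_cases hxj : x ∈ gridCell m j
    · rw [Set.indicator_of_mem hxj, Set.indicator_of_mem hxj, mul_comm]
    · rw [Set.indicator_of_notMem hxj, Set.indicator_of_notMem hxj, mul_zero]
  have h2 := (ae_ball_iff J.countable_toSet).2 fun j (_ : j ∈ (J : Set (Fin n → ℤ))) => h1 j
  filter_upwards [Lp.coeFn_fun_finsetSum J fun j => (∫ x in gridCell m j, φ x) •
      indicatorConstLp p (measurableSet_gridCell m j)
        (measure_ne_top (volume.restrict (Ω : Set (EuclideanSpace ℝ (Fin n)))) _)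
        (((volume (gridCell m j)).toReal⁻¹ : ℝ) : 𝕜), h2] with x hx hx2
  rw [hx, Finset.sum_congr rfl hx2]
  by_cases hxJ : gridIndex m x ∈ J
  · rw [Set.indicator_of_mem (show x ∈ gridIndex m ⁻¹' (J : Set (Fin n → ℤ)) from hxJ),
      Finset.sum_eq_single_of_mem _ hxJ]
    · exact Set.indicator_of_mem (show x ∈ gridCell m (gridIndex m x) from rfl) _
    · exact fun j _ hj => Set.indicator_of_notMem (s := gridCell m j) (fun h => hj (Eq.symm h)) _
  · rw [Set.indicator_of_notMem (show x ∉ gridIndex m ⁻¹' (J : Set (Fin n → ℤ)) from hxJ)]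
    exact Finset.sum_eq_zero fun j hj =>
      Set.indicator_of_notMem (s := gridCell m j)
        (fun h => hxJ ((show gridIndex m x = j from h) ▸ hj)) _

theorem enorm_sub_gridProjection_le (hp : p ≠ ∞) {m : ℕ} (hm : 0 < m) (J : Finset (Fin n → ℤ))
    {u : LpOn 𝕜 Ω p} {φ : 𝓓(Ω, 𝕜)}
    (hu : u =ᵐ[volume.restrict (Ω : Set (EuclideanSpace ℝ (Fin n)))] φ) :
    ‖u - gridProjection 𝕜 Ω p m J u‖ₑ ≤
      ((2 : ℝ≥0∞) ^ n) ^ (1 / p.toReal) * ENNReal.ofReal (n / m) *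
        eLpNorm (fderiv ℝ φ) p volume +
      (ENNReal.ofReal (1 / m) ^ n)⁻¹ * volume (Ω : Set (EuclideanSpace ℝ (Fin n))) ^
          (1 - 1 / p.toReal) *
        volume.restrict (Ω : Set (EuclideanSpace ℝ (Fin n)))
          (gridIndex m ⁻¹' (J : Set (Fin n → ℤ)))ᶜ ^ (1 / p.toReal) * ‖u‖ₑ := by
  have hp1 : 1 ≤ p := Fact.out
  have hp0 : p ≠ 0 := (zero_lt_one.trans_le hp1).ne'
  set μ := volume.restrict (Ω : Set (EuclideanSpace ℝ (Fin n))) with hμ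
  set A : Set (EuclideanSpace ℝ (Fin n)) := gridIndex m ⁻¹' (J : Set (Fin n → ℤ)) with hA
  have hAm : MeasurableSet A := measurable_gridIndex m (Set.to_countable _).measurableSet
  have hG := stronglyMeasurable_gridAverage m φ
  have hae : (u - gridProjection 𝕜 Ω p m J u : LpOn 𝕜 Ω p) =ᵐ[μ]
      A.indicator (⇑φ - gridAverage m φ) + Aᶜ.indicator φ := by
    filter_upwards [Lp.coeFn_sub u (gridProjection 𝕜 Ω p m J u), hu,
      gridProjection_ae_eq hu m J] with x h1 h2 h3
    rw [h1, Pi.sub_apply, h2, h3, Pi.add_apply, ← hA]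
    by_cases hx : x ∈ A <;> simp [hx]
  -- The error off `A` is `φ` itself, which the measure of `Aᶜ` alone does not control. Adding and
  -- subtracting the average there leaves a Poincaré term on all of `Ω` and a tail of the bounded
  -- function `gridAverage m φ`.
  have hsplit : A.indicator (⇑φ - gridAverage m φ) + Aᶜ.indicator φ =
      (⇑φ - gridAverage m φ) + Aᶜ.indicator (gridAverage m φ) := by
    ext x
    by_cases hx : x ∈ A <;> simp [hx]
  rw [Lp.enorm_def, eLpNorm_congr_ae hae, hsplit]
  refine (eLpNorm_add_le ((φ.continuous.aestronglyMeasurable).sub hG.aestronglyMeasurable)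
    (hG.indicator hAm.compl).aestronglyMeasurable hp1).trans (add_le_add ?_ ?_)
  · exact (eLpNorm_mono_measure _ Measure.restrict_le_self).trans
      (eLpNorm_sub_gridAverage_le hm (φ.contDiff.of_le (by simp)) (φ.continuous.integrable_of_hasCompactSupport φ.hasCompactSupport)
        hp1 hp)
  · have h1 : ∫⁻ x, ‖φ x‖ₑ ≤
        ‖u‖ₑ * volume (Ω : Set (EuclideanSpace ℝ (Fin n))) ^ (1 - 1 / p.toReal) := by
      have h2 := lintegral_enorm_le_eLpNorm_mul hp1 (Lp.aestronglyMeasurable u)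
      rw [← Lp.enorm_def, Measure.restrict_apply_univ] at h2
      refine le_trans (le_of_eq ?_) h2
      have h3 : ∫⁻ x, ‖u x‖ₑ ∂μ = ∫⁻ x, ‖φ x‖ₑ ∂μ := lintegral_congr_ae (hu.fun_comp enorm)
      rw [h3]
      symm
      refine setLIntegral_eq_of_support_subset fun x hx => TestFunction.support_subset φ ?_
      simpa using hx
    set K := (ENNReal.ofReal (1 / m) ^ n)⁻¹ * ∫⁻ x, ‖φ x‖ₑ with hK
    calc eLpNorm (Aᶜ.indicator (gridAverage m φ)) p μ
        ≤ eLpNorm (Aᶜ.indicator fun _ => K) p μ := by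
          refine eLpNorm_mono_enorm fun x => ?_
          by_cases hx : x ∈ A
          · simp [hx]
          · have hx : x ∈ Aᶜ := hx
            rw [Set.indicator_of_mem hx, Set.indicator_of_mem hx]
            exact enorm_gridAverage_le hm φ x
      _ = K * μ Aᶜ ^ (1 / p.toReal) := by
          rw [eLpNorm_indicator_const hAm.compl hp0 hp, enorm_eq_self]
      _ ≤ _ := by
          rw [hK]
          calc _ ≤ (ENNReal.ofReal (1 / m) ^ n)⁻¹ * (‖u‖ₑ *
                volume (Ω : Set (EuclideanSpace ℝ (Fin n))) ^ (1 - 1 / p.toReal)) *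
                  μ Aᶜ ^ (1 / p.toReal) := by gcongr
            _ = _ := by ring

/-- Continuity from above for a finite measure: every point lies in some cell, so the complements
decrease to `∅`. -/
theorem tendsto_measure_compl_gridIndex_preimage (m : ℕ) {μ : Measure (EuclideanSpace ℝ (Fin n))}
    [IsFiniteMeasure μ] :
    Tendsto (fun J : Finset (Fin n → ℤ) => μ (gridIndex m ⁻¹' (J : Set (Fin n → ℤ)))ᶜ) atTop
      (𝓝 0) := by
  have h := tendsto_measure_iInter_atTop (μ := μ)
    (s := fun J : Finset (Fin n → ℤ) => (gridIndex m ⁻¹' (J : Set (Fin n → ℤ)))ᶜ)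
    (fun J => (measurable_gridIndex m
      (Set.to_countable _).measurableSet).compl.nullMeasurableSet)
    (fun J J' hJ => Set.compl_subset_compl.2 (Set.preimage_mono (by exact_mod_cast hJ)))
    ⟨∅, measure_ne_top _ _⟩
  have e : ⋂ J : Finset (Fin n → ℤ), (gridIndex m ⁻¹' (J : Set (Fin n → ℤ)) :
      Set (EuclideanSpace ℝ (Fin n)))ᶜ = ∅ := by
    ext x
    simp only [Set.mem_iInter, Set.mem_compl_iff, Set.mem_preimage, Set.mem_empty_iff_false,
      iff_false, not_forall, not_not]
    exact ⟨{gridIndex m x}, by simp⟩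
  rw [e, measure_empty] at h
  exact h

/-- The mesh is chosen before `J`: the second term carries a factor `m ^ n`, harmless once `m` is
fixed. The extra factor `n` in the first term comes from the gradient bound. -/
theorem exists_grid_error_le {C : ℝ≥0∞} (hC : C ≠ ∞) {r : ℝ} (hr : 0 < r) {D : ℝ≥0∞} (hD : D ≠ ∞)
    {μ : Measure (EuclideanSpace ℝ (Fin n))} [IsFiniteMeasure μ] {ε : ℝ≥0∞} (hε : ε ≠ 0) :
    ∃ m : ℕ, 0 < m ∧ ∃ J : Finset (Fin n → ℤ), C * ENNReal.ofReal (n / m) * n +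
      (ENNReal.ofReal (1 / m) ^ n)⁻¹ * D * μ (gridIndex m ⁻¹' (J : Set (Fin n → ℤ)))ᶜ ^ r
        ≤ ε := by
  have h1 : Tendsto (fun m : ℕ => C * ENNReal.ofReal (n / m) * n) atTop (𝓝 0) := by
    have h := (ENNReal.tendsto_ofReal (tendsto_const_div_atTop_nhds_zero_nat (n : ℝ)))
    have h' := ENNReal.Tendsto.mul_const (b := (n : ℝ≥0∞))
      (ENNReal.Tendsto.const_mul (a := C) h (Or.inr hC)) (Or.inr (ENNReal.natCast_ne_top n))
    simpa using h'
  have hε2 : 0 < ε / 2 := ENNReal.half_pos hε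
  obtain ⟨m, hm, hm0⟩ := ((h1.eventually (Iic_mem_nhds hε2)).and (eventually_gt_atTop 0)).exists
  refine ⟨m, hm0, ?_⟩
  have hE : (ENNReal.ofReal (1 / m) ^ n)⁻¹ * D ≠ ∞ := by
    refine ENNReal.mul_ne_top (ENNReal.inv_ne_top.2 ?_) hD
    exact pow_ne_zero _ (ENNReal.ofReal_pos.2 (by positivity)).ne'
  have h2 : Tendsto (fun J : Finset (Fin n → ℤ) => (ENNReal.ofReal (1 / m) ^ n)⁻¹ * D *
      μ (gridIndex m ⁻¹' (J : Set (Fin n → ℤ)))ᶜ ^ r) atTop (𝓝 0) := by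
    have h := ((tendsto_measure_compl_gridIndex_preimage m (μ := μ)).ennrpow_const r)
    have h' := ENNReal.Tendsto.const_mul (a := (ENNReal.ofReal (1 / m) ^ n)⁻¹ * D) h (Or.inr hE)
    simpa [ENNReal.zero_rpow_of_pos hr] using h'
  obtain ⟨J, hJ⟩ := (h2.eventually (Iic_mem_nhds hε2)).exists
  exact ⟨J, (add_le_add hm hJ).trans_eq (ENNReal.add_halves ε)⟩

theorem exists_gridProjection_approx (hp : p ≠ ∞) {k : ℕ} (hk : 1 ≤ k) {ε : ℝ} (hε : 0 < ε) :
    ∃ m J, ∀ u ∈ SobolevSpaceZero 𝕜 Ω k p,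
      ‖SobolevSpace.toLpCLM 𝕜 Ω k p u -
        gridProjection 𝕜 Ω p m J (SobolevSpace.toLpCLM 𝕜 Ω k p u)‖ ≤ ε * ‖u‖ := by
  have hp1 : 1 ≤ p := Fact.out
  have hr : 1 ≤ p.toReal := by simpa using ENNReal.toReal_mono hp hp1
  have hvol : volume (Ω : Set (EuclideanSpace ℝ (Fin n))) ≠ ∞ := by
    simpa using measure_ne_top (volume.restrict (Ω : Set (EuclideanSpace ℝ (Fin n)))) Set.univ
  obtain ⟨m, hm, J, hJ⟩ := exists_grid_error_le (n := n)
    (C := ((2 : ℝ≥0∞) ^ n) ^ (1 / p.toReal))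
    (ENNReal.rpow_ne_top_of_nonneg (by positivity) (ENNReal.pow_ne_top ENNReal.ofNat_ne_top))
    (r := 1 / p.toReal) (by positivity)
    (ENNReal.rpow_ne_top_of_nonneg (one_sub_one_div_toReal_nonneg hp1) hvol)
    (μ := volume.restrict (Ω : Set (EuclideanSpace ℝ (Fin n)))) (ENNReal.ofReal_pos.2 hε).ne'
  refine ⟨m, J, fun u hu => ?_⟩
  have hcl : IsClosed {u : SobolevSpace 𝕜 Ω k p | ‖SobolevSpace.toLpCLM 𝕜 Ω k p u -
      gridProjection 𝕜 Ω p m J (SobolevSpace.toLpCLM 𝕜 Ω k p u)‖ ≤ ε * ‖u‖} :=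
    isClosed_le (by fun_prop) (by fun_prop)
  -- The estimate is a closed condition in the Sobolev norm, so test functions suffice.
  refine closure_minimal ?_ hcl hu
  rintro v ⟨φ, hφ⟩
  have h1 := enorm_sub_gridProjection_le hp hm J hφ
  have h2 := SobolevSpace.eLpNorm_fderiv_le hk hφ
  have h3 : ‖SobolevSpace.toLp v‖ₑ ≤ ‖v‖ₑ := by
    rw [← ofReal_norm, ← ofReal_norm]
    exact ENNReal.ofReal_le_ofReal (SobolevSpace.norm_toLp_le v)
  have h4 : ‖SobolevSpace.toLp v - gridProjection 𝕜 Ω p m J (SobolevSpace.toLp v)‖ₑ ≤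
      ENNReal.ofReal ε * ‖v‖ₑ := by
    refine h1.trans ((add_le_add (mul_le_mul' le_rfl h2) (mul_le_mul' le_rfl h3)).trans ?_)
    rw [← mul_assoc, ← add_mul]
    exact mul_le_mul' hJ le_rfl
  rw [← ofReal_norm, ← ofReal_norm, ← ENNReal.ofReal_mul hε.le,
    ENNReal.ofReal_le_ofReal_iff (by positivity)] at h4
  exact h4

end GridProjection

theorem isCompactOperator_of_forall_exists_norm_sub_le {𝕜 X Y : Type*} [NontriviallyNormedField 𝕜]
    [NormedAddCommGroup X] [NormedSpace 𝕜 X] [NormedAddCommGroup Y] [NormedSpace 𝕜 Y]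
    [CompleteSpace Y] (T : X →L[𝕜] Y)
    (h : ∀ ε > 0, ∃ S : X →L[𝕜] Y, IsCompactOperator S ∧ ∀ x, ‖T x - S x‖ ≤ ε * ‖x‖) :
    IsCompactOperator T := by
  refine isClosed_setOfPred_isCompactOperator.closure_subset
    (Metric.mem_closure_iff.2 fun ε hε => ?_)
  -- Half of `ε` turns the non-strict bound into the strict one required for the closure.
  obtain ⟨S, hS, hTS⟩ := h (ε / 2) (half_pos hε)
  refine ⟨S, hS, ?_⟩
  rw [dist_eq_norm]
  exact lt_of_le_of_lt (ContinuousLinearMap.opNorm_le_bound _ (half_pos hε).le hTS)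
    (half_lt_self hε)

theorem SobolevSpaceZero.isCompactOperator_inclusion {𝕜 : Type*} [RCLike 𝕜] {n : ℕ}
    (Ω : Opens (EuclideanSpace ℝ (Fin n)))
    (hvol : volume (Ω : Set (EuclideanSpace ℝ (Fin n))) < ∞)
    {k : ℕ} (hk : 1 ≤ k) {p : ℝ≥0∞} [Fact (1 ≤ p)] (hp : p ≠ ∞) :
    IsCompactOperator (SobolevSpaceZero.inclusion 𝕜 Ω k p) := by
  have : IsFiniteMeasure (volume.restrict (Ω : Set (EuclideanSpace ℝ (Fin n)))) :=
    ⟨by simpa using hvol⟩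
  let ι : SobolevSpaceZero 𝕜 Ω k p →L[𝕜] LpOn 𝕜 Ω p :=
    SobolevSpace.toLpCLM 𝕜 Ω k p ∘L (SobolevSpaceZero 𝕜 Ω k p).subtypeL
  refine isCompactOperator_of_forall_exists_norm_sub_le ι fun ε hε => ?_
  obtain ⟨m, J, h⟩ := exists_gridProjection_approx (𝕜 := 𝕜) (Ω := Ω) hp hk hε
  exact ⟨gridProjection 𝕜 Ω p m J ∘L ι, (isCompactOperator_gridProjection m J).comp_clm ι,
    fun u => h u.1 u.2⟩

theorem corollary3p8 {𝕜 : Type*} [RCLike 𝕜] {n : ℕ} (hn : 1 ≤ n)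
    (Ω : Opens (EuclideanSpace ℝ (Fin n)))
    (hΩ : (Ω : Set (EuclideanSpace ℝ (Fin n))).Nonempty)
    (hvol : volume (Ω : Set (EuclideanSpace ℝ (Fin n))) < ∞)
    (k : ℕ) (hk : 1 ≤ k) (p : ℝ≥0∞) [Fact (1 ≤ p)] (hp : p ≠ ∞) :
    Function.Injective (SobolevSpaceZero.inclusion 𝕜 Ω k p) ∧
      Continuous (SobolevSpaceZero.inclusion 𝕜 Ω k p) ∧
      IsCompactOperator (SobolevSpaceZero.inclusion 𝕜 Ω k p) :=
  ⟨SobolevSpace.toLp_injective.comp Subtype.val_injective,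
    (SobolevSpace.toLpCLM 𝕜 Ω k p).continuous.comp continuous_subtype_val,
    SobolevSpaceZero.isCompactOperator_inclusion Ω hvol hk hp⟩
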